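/- **Theorem 2.1.** Let $j\ge 1$ be an integer and let $q$ be a complex number with $|q|<1$. Write $(A)_0=1$, $(A)_n=(1-A)(1-Aq)\cdots(1-Aq^{n-1})$ for $n\ge 1$, and $(A)_\infty=\lim_{n\to\infty}(A)_n$. Then $$\sum_{n_j\ge 1}\ \sum_{n_j\ge n_{j-1}\ge\cdots\ge n_1\ge 0}\frac{q^{n_1^2+\cdots+n_{j-1}^2+n_j}\,(q)_{n_j}}{(q)_{n_1}(q)_{n_2-n_1}\cdots(q)_{n_j-n_{j-1}}\,(1-q^{n_j})^2\,(q^{n_j+1})_\infty} =\frac{1}{(q)_\infty}\sum_{n=1}^\infty\frac{nq^n}{1-q^n}+\frac{1}{(q)_\infty}\sum_{n=1}^\infty\frac{(-1)^nq^{n((2j+1)n+1)/2}(1+q^n)}{(1-q^n)^2},$$ where all three series converge absolutely. (For $j=1$ the sum on the left runs over $n_1\ge 1$ only, and the product $(q)_{n_1}(q)_{n_2-n_1}\cdots(q)_{n_j-n_{j-1}}$ is $(q)_{n_1}$.) -/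

import Mathlib

open Filter Topology

/-- The finite `q`-shifted factorial `(A; q)_n = (1 - A)(1 - A q) ⋯ (1 - A q ^ (n - 1))`,
with `(A; q)_0 = 1`. -/
noncomputable def qPoch (A q : ℂ) (n : ℕ) : ℂ :=
  ∏ k ∈ Finset.range n, (1 - A * q ^ k)

/-- The infinite `q`-shifted factorial `(A; q)_∞ = ∏_{k ≥ 0} (1 - A q ^ k)`, for `|q| < 1`. -/
noncomputable def qPochInf (A q : ℂ) : ℂ :=
  ∏' k : ℕ, (1 - A * q ^ k)

/-- For `|q| < 1` the product above converges and `(A; q)_∞ = lim_{n → ∞} (A; q)_n`. -/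
theorem tendsto_qPoch (A q : ℂ) (hq : ‖q‖ < 1) :
    Tendsto (qPoch A q) atTop (𝓝 (qPochInf A q)) := by
  have hs : Summable fun k : ℕ => ‖-(A * q ^ k)‖ := by
    simpa [norm_mul, norm_pow] using
      (summable_geometric_of_lt_one (norm_nonneg q) hq).mul_left ‖A‖
  have hm : Multipliable fun k : ℕ => (1 - A * q ^ k) := by
    simpa [sub_eq_add_neg] using multipliable_one_add_of_summable hs
  exact hm.hasProd.tendsto_prod_nat

/-- The range of summation of the multiple sum: all integer sequences
`0 = n_0 ≤ n_1 ≤ ⋯ ≤ n_{j-1} ≤ n_j` with `n_j ≥ 1`. The entry `n_0 = 0` is only a convention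
that makes the factor `(q)_{n_1}` the first of the factors `(q)_{n_i - n_{i-1}}`. -/
def chains (j : ℕ) : Set (Fin (j + 1) → ℕ) :=
  {n | Monotone n ∧ n 0 = 0 ∧ 1 ≤ n (Fin.last j)}

/-- The summand
`q ^ (n_1² + ⋯ + n_{j-1}² + n_j) (q)_{n_j} /
  ((q)_{n_1} (q)_{n_2 - n_1} ⋯ (q)_{n_j - n_{j-1}} (1 - q ^ n_j)² (q ^ (n_j + 1))_∞)`.
Here `i : Fin j` is read as the index `i = 0, …, j - 1`, and the square of `n_0 = 0` adds nothing
to the exponent. -/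
noncomputable def chainTerm (q : ℂ) (j : ℕ) (n : Fin (j + 1) → ℕ) : ℂ :=
  q ^ ((∑ i : Fin j, n i.castSucc ^ 2) + n (Fin.last j)) * qPoch q q (n (Fin.last j)) /
    ((∏ i : Fin j, qPoch q q (n i.succ - n i.castSucc)) *
      (1 - q ^ n (Fin.last j)) ^ 2 * qPochInf (q ^ (n (Fin.last j) + 1)) q)

/-- The term `n q ^ n / (1 - q ^ n)`. -/
noncomputable def lambertTerm (q : ℂ) (n : ℕ) : ℂ :=
  n * q ^ n / (1 - q ^ n)

/-- The exponent `n ((2 j + 1) n + 1) / 2` is an integer, so that the division by two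
of natural numbers below is exact. -/
theorem two_dvd_exponent (j n : ℕ) : 2 ∣ n * ((2 * j + 1) * n + 1) := by
  rcases Nat.even_or_odd n with h | h
  · exact (h.mul_right _).two_dvd
  · refine (Even.mul_left ?_ n).two_dvd
    exact ((odd_two_mul_add_one j).mul h).add_one

/-- The term `(-1) ^ n q ^ (n ((2 j + 1) n + 1) / 2) (1 + q ^ n) / (1 - q ^ n)²`. -/
noncomputable def rankTerm (q : ℂ) (j n : ℕ) : ℂ :=
  (-1) ^ n * q ^ (n * ((2 * j + 1) * n + 1) / 2) * (1 + q ^ n) / (1 - q ^ n) ^ 2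

/-!
The factors `(q)_{n_i - n_{i-1}}` and `q ^ (n_i²)` of the summand are those produced by iterating
Bailey's lemma. For fixed `n_j = N` the inner sum is the second member `β N` of the Bailey pair
(relative to `a = 1`) that arises from the unit pair by `j` applications of Bailey's lemma with both
parameters sent to infinity (`hasSum_chainWeight`, `IsBaileyPair.step`); its first member is
`α r = (-1) ^ r q ^ (j r² + r (r - 1) / 2) (1 + q ^ r)` for `r ≥ 1`, and `α 0 = 1`.
The step rests on a finite `q`-Vandermonde sum, and the unit pair on a telescoping sum.

What remains of the summand is `(q)_{N-1}² q ^ N / (q)_∞` (`lastFactor_succ`), so the left side is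
`1 / (q)_∞` times `∑ (q)_{N-1}² q ^ N β N`. Inserting `β N = ∑ α r / ((q)_{N-r} (q)_{N+r})` and
interchanging the sums (`tsum_baileyPair`), the coefficient of `α r` for `r ≥ 1` is
`∑_N (q)_{N-1}² q ^ N / ((q)_{N-r} (q)_{N+r}) = q ^ r / (1 - q ^ r)²`. This telescopes, since
`(1 - q ^ r)²` times the `N`-th term is `q ^ r` times the increment of
`(q)_N² / ((q)_{N-r} (q)_{N+r})`, which tends to `1` (`hasSum_baileyCoeff`). These terms give the
second series on the right. The coefficient of `α 0` is `∑ q ^ N / (1 - q ^ N)²`, which is the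
Lambert series `∑ n q ^ n / (1 - q ^ n)`: both are iterated sums of one double series.
-/

/-! ### Finite shifted factorials -/

open Finset in
theorem qPoch_self_succ (q : ℂ) (n : ℕ) :
    qPoch q q (n + 1) = qPoch q q n * (1 - q ^ (n + 1)) := by
  simp [qPoch, prod_range_succ, pow_succ']

theorem qPoch_zero (A q : ℂ) : qPoch A q 0 = 1 := by simp [qPoch]

theorem qPoch_add (A q : ℂ) (n k : ℕ) :
    qPoch A q (n + k) = qPoch A q n * qPoch (A * q ^ n) q k := by
  simp [qPoch, Finset.prod_range_add, pow_add, mul_assoc]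

theorem one_sub_pow_succ_ne_zero {q : ℂ} (hq : ‖q‖ < 1) (n : ℕ) : 1 - q ^ (n + 1) ≠ 0 := by
  intro h
  have h1 : ‖q ^ (n + 1)‖ < 1 := by
    rw [norm_pow]
    exact pow_lt_one₀ (norm_nonneg _) hq n.succ_ne_zero
  rw [← sub_eq_zero.mp h] at h1
  simp at h1

theorem qPoch_self_ne_zero {q : ℂ} (hq : ‖q‖ < 1) (n : ℕ) : qPoch q q n ≠ 0 := by
  induction n with
  | zero => simp [qPoch_zero]
  | succ n ih =>
    rw [qPoch_self_succ]
    exact mul_ne_zero ih (one_sub_pow_succ_ne_zero hq n)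

/-! ### Bailey pairs and Bailey's lemma -/

open Finset in
/-- A limiting case of the `q`-Vandermonde sum. With `q`-binomial coefficients it reads
`∑_k q ^ (k (k + c)) [m choose k] / (q)_{k+c} = 1 / (q)_{m+c}`; by the `q`-Pascal rule the left side
for `(m + 1, c)` equals that for `(m, c + 1)`. -/
theorem sum_antidiagonal_qVandermonde {q : ℂ} (hq : ‖q‖ < 1) (m c : ℕ) :
    ∑ p ∈ antidiagonal m, q ^ (p.1 * (p.1 + c)) /
        (qPoch q q p.1 * qPoch q q p.2 * qPoch q q (p.1 + c)) =
      1 / (qPoch q q m * qPoch q q (m + c)) := by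
  induction m generalizing c with
  | zero => simp [qPoch_zero]
  | succ m ih =>
    have hne := qPoch_self_ne_zero hq
    have h1 := one_sub_pow_succ_ne_zero hq
    have key : (1 - q ^ (m + 1)) * ∑ p ∈ antidiagonal (m + 1), q ^ (p.1 * (p.1 + c)) /
          (qPoch q q p.1 * qPoch q q p.2 * qPoch q q (p.1 + c)) =
        ∑ p ∈ antidiagonal m, q ^ (p.1 * (p.1 + (c + 1))) /
          (qPoch q q p.1 * qPoch q q p.2 * qPoch q q (p.1 + (c + 1))) := by
      -- the `q`-Pascal rule: `1 - q ^ (k + l) = q ^ k (1 - q ^ l) + (1 - q ^ k)`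
      have split : (1 - q ^ (m + 1)) * ∑ p ∈ antidiagonal (m + 1), q ^ (p.1 * (p.1 + c)) /
            (qPoch q q p.1 * qPoch q q p.2 * qPoch q q (p.1 + c)) =
          ∑ p ∈ antidiagonal (m + 1), q ^ p.1 * (1 - q ^ p.2) * (q ^ (p.1 * (p.1 + c)) /
            (qPoch q q p.1 * qPoch q q p.2 * qPoch q q (p.1 + c))) +
          ∑ p ∈ antidiagonal (m + 1), (1 - q ^ p.1) * (q ^ (p.1 * (p.1 + c)) /
            (qPoch q q p.1 * qPoch q q p.2 * qPoch q q (p.1 + c))) := by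
        rw [mul_sum, ← sum_add_distrib]
        refine sum_congr rfl fun p hp => ?_
        rw [← mem_antidiagonal.mp hp, pow_add]
        ring
      rw [split, Nat.sum_antidiagonal_succ', Nat.sum_antidiagonal_succ]
      simp only [pow_zero, sub_self, mul_zero, zero_mul, zero_add]
      rw [← sum_add_distrib]
      refine sum_congr rfl fun p _ => ?_
      obtain ⟨k, l⟩ := p
      simp only
      have e1 : k + 1 + c = k + c + 1 := by ring
      have e2 : k + (c + 1) = k + c + 1 := by ring
      rw [e1, e2, qPoch_self_succ q k, qPoch_self_succ q l, qPoch_self_succ q (k + c)]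
      have := hne k
      have := hne l
      have := hne (k + c)
      have := h1 k
      have := h1 l
      have := h1 (k + c)
      field_simp
      ring
    rw [ih, show m + (c + 1) = m + 1 + c by ring] at key
    have := hne m
    have := hne (m + 1 + c)
    have := h1 m
    rw [qPoch_self_succ]
    refine mul_left_cancel₀ this (key.trans ?_)
    field_simp

/-- `(α, β)` is a Bailey pair relative to `a = 1`:
`β n = ∑_{r ≤ n} α r / ((q)_{n-r} (q)_{n+r})`. -/
def IsBaileyPair (q : ℂ) (α β : ℕ → ℂ) : Prop :=
  ∀ n, β n = ∑ r ∈ Finset.range (n + 1), α r / (qPoch q q (n - r) * qPoch q q (n + r))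

/-- The effect of Bailey's lemma, with both parameters sent to infinity, on the second member of
a Bailey pair. -/
noncomputable def baileyStep (q : ℂ) (β : ℕ → ℂ) (n : ℕ) : ℂ :=
  ∑ s ∈ Finset.range (n + 1), q ^ s ^ 2 * β s / qPoch q q (n - s)

open Finset in
/-- Bailey's lemma with both parameters sent to infinity. -/
theorem IsBaileyPair.step {q : ℂ} (hq : ‖q‖ < 1) {α β : ℕ → ℂ} (h : IsBaileyPair q α β) :
    IsBaileyPair q (fun r => q ^ r ^ 2 * α r) (baileyStep q β) := by
  intro n
  have e : baileyStep q β n = ∑ s ∈ Ico 0 (n + 1), ∑ r ∈ Ico 0 (s + 1),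
      q ^ s ^ 2 * (α r / (qPoch q q (s - r) * qPoch q q (s + r))) / qPoch q q (n - s) := by
    rw [baileyStep, range_eq_Ico]
    refine sum_congr rfl fun s _ => ?_
    rw [h s, range_eq_Ico, mul_sum, sum_div]
  rw [e, ← sum_Ico_Ico_comm, ← range_eq_Ico]
  refine sum_congr rfl fun r hr => ?_
  have hr' : r ≤ n := Nat.lt_succ_iff.mp (mem_range.mp hr)
  obtain ⟨m, rfl⟩ := Nat.exists_eq_add_of_le hr'
  have v := sum_antidiagonal_qVandermonde hq m (2 * r)
  rw [Nat.sum_antidiagonal_eq_sum_range_succ_mk] at v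
  rw [sum_Ico_eq_sum_range, show r + m + 1 - r = m + 1 by omega, show r + m - r = m by omega,
    show r + m + r = m + 2 * r by ring, div_eq_mul_one_div, ← v, mul_sum]
  refine sum_congr rfl fun k hk => ?_
  rw [show r + m - (r + k) = m - k by omega, show r + k - r = k by omega,
    show r + k + r = k + 2 * r by ring, show (r + k) ^ 2 = r ^ 2 + k * (k + 2 * r) by ring, pow_add]
  field_simp

/-! ### The Bailey chain of the unit pair -/

/-- The first member of the `j`-th Bailey pair in the chain that starts at the unit pair. The value
at `0` is `1`, not the value `2` of the general formula. -/
noncomputable def baileyAlpha (q : ℂ) (j r : ℕ) : ℂ :=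
  if r = 0 then 1 else (-1) ^ r * q ^ (j * r ^ 2 + r * (r - 1) / 2) * (1 + q ^ r)

/-- The second member of the `j`-th Bailey pair in the chain that starts at the unit pair, whose own
second member is `1` at `0` and `0` elsewhere. -/
noncomputable def baileyBeta (q : ℂ) : ℕ → ℕ → ℂ
  | 0, n => if n = 0 then 1 else 0
  | j + 1, n => baileyStep q (baileyBeta q j) n

open Finset in
/-- The partial sums of the inversion relation that defines the unit Bailey pair telescope. -/
theorem sum_baileyAlpha_zero {q : ℂ} (hq : ‖q‖ < 1) (M l : ℕ) :
    ∑ r ∈ range (M + 1), baileyAlpha q 0 r /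
        (qPoch q q (M + l + 1 - r) * qPoch q q (M + l + 1 + r)) =
      (-1) ^ M * q ^ ((M + 1) * M / 2) /
        (qPoch q q l * qPoch q q (M + l + 1 + M) * (1 - q ^ (M + l + 1))) := by
  have hne := qPoch_self_ne_zero hq
  have h1 := one_sub_pow_succ_ne_zero hq
  induction M generalizing l with
  | zero =>
    have := hne l
    have := h1 l
    simp [baileyAlpha, qPoch_self_succ]
    field_simp
  | succ M ih =>
    have e : (M + 1 + 1) * (M + 1) / 2 = (M + 1) * M / 2 + (M + 1) := by
      rw [show (M + 1 + 1) * (M + 1) = (M + 1) * M + (M + 1) * 2 by ring,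
        Nat.add_mul_div_right _ _ two_pos]
    rw [sum_range_succ, show M + 1 + l + 1 = M + (l + 1) + 1 by ring, ih,
      show M + (l + 1) + 1 - (M + 1) = l + 1 by omega, baileyAlpha, if_neg M.succ_ne_zero, e,
      show M + (l + 1) + 1 + (M + 1) = M + (l + 1) + 1 + M + 1 by ring, qPoch_self_succ q l,
      qPoch_self_succ q (M + (l + 1) + 1 + M)]
    simp only [zero_mul, zero_add, Nat.add_sub_cancel]
    have := hne l
    have := h1 l
    have := hne (M + (l + 1) + 1 + M)
    have := h1 (M + (l + 1) + 1 + M)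
    have := h1 (M + (l + 1))
    field_simp
    ring

open Finset in
theorem isBaileyPair_unit {q : ℂ} (hq : ‖q‖ < 1) :
    IsBaileyPair q (baileyAlpha q 0) (baileyBeta q 0) := by
  intro n
  rcases n with _ | n
  · simp [baileyBeta, baileyAlpha, qPoch_zero]
  have hne := qPoch_self_ne_zero hq
  have e : (n + 1 + 1) * (n + 1) / 2 = (n + 1) * n / 2 + (n + 1) := by
    rw [show (n + 1 + 1) * (n + 1) = (n + 1) * n + (n + 1) * 2 by ring,
      Nat.add_mul_div_right _ _ two_pos]
  have h := sum_baileyAlpha_zero hq n 0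
  simp only [add_zero] at h
  rw [sum_range_succ, h, baileyAlpha, if_neg n.succ_ne_zero, Nat.sub_self, qPoch_zero,
    show n + 1 + (n + 1) = n + 1 + n + 1 by ring, qPoch_self_succ q (n + 1 + n)]
  simp only [baileyBeta, if_neg n.succ_ne_zero, zero_mul, zero_add, Nat.add_sub_cancel]
  have := hne (n + 1 + n)
  have := one_sub_pow_succ_ne_zero hq (n + 1 + n)
  have := one_sub_pow_succ_ne_zero hq n
  field_simp
  ring

theorem isBaileyPair_baileyAlpha_baileyBeta {q : ℂ} (hq : ‖q‖ < 1) (j : ℕ) :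
    IsBaileyPair q (baileyAlpha q j) (baileyBeta q j) := by
  induction j with
  | zero => exact isBaileyPair_unit hq
  | succ j ih =>
    convert ih.step hq using 2 with r
    · unfold baileyAlpha
      split_ifs with hr
      · simp [hr]
      · rw [show (j + 1) * r ^ 2 + r * (r - 1) / 2 = r ^ 2 + (j * r ^ 2 + r * (r - 1) / 2) by ring,
          pow_add]
        ring
    · rfl

/-! ### The infinite product and bounds -/

theorem qPochInf_self_ne_zero {q : ℂ} (hq : ‖q‖ < 1) : qPochInf q q ≠ 0 := by
  have h := tprod_one_add_ne_zero_of_summable (f := fun k : ℕ => -(q * q ^ k)) (fun k => by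
    simpa [← sub_eq_add_neg, ← pow_succ'] using one_sub_pow_succ_ne_zero hq k) (by
    simpa [norm_mul, norm_pow] using
      (summable_geometric_of_lt_one (norm_nonneg q) hq).mul_left ‖q‖)
  simpa [qPochInf, sub_eq_add_neg] using h

theorem qPoch_mul_qPochInf {q : ℂ} (hq : ‖q‖ < 1) (n : ℕ) :
    qPoch q q n * qPochInf (q ^ (n + 1)) q = qPochInf q q := by
  have h1 := (tendsto_qPoch (q ^ (n + 1)) q hq).const_mul (qPoch q q n)
  have h2 := (tendsto_qPoch q q hq).comp (tendsto_add_atTop_nat n)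
  refine tendsto_nhds_unique h1 (h2.congr fun k => ?_)
  simp only [Function.comp_apply]
  rw [add_comm k n, qPoch_add, pow_succ']

theorem exists_norm_qPoch_le {q : ℂ} (hq : ‖q‖ < 1) : ∃ C, 0 < C ∧ ∀ n, ‖qPoch q q n‖ ≤ C := by
  obtain ⟨C, hC⟩ := (Metric.isBounded_range_of_tendsto _ (tendsto_qPoch q q hq)).exists_norm_le
  exact ⟨max C 1, by positivity, fun n => (hC _ ⟨n, rfl⟩).trans (le_max_left _ _)⟩

theorem exists_norm_qPoch_inv_le {q : ℂ} (hq : ‖q‖ < 1) :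
    ∃ C, 0 < C ∧ ∀ n, ‖(qPoch q q n)⁻¹‖ ≤ C := by
  obtain ⟨C, hC⟩ := (Metric.isBounded_range_of_tendsto _
    ((tendsto_qPoch q q hq).inv₀ (qPochInf_self_ne_zero hq))).exists_norm_le
  exact ⟨max C 1, by positivity, fun n => (hC _ ⟨n, rfl⟩).trans (le_max_left _ _)⟩

/-! ### The Lambert series -/

/-- The two iterated sums of `∑ c q ^ (d c)` over `c, d ≥ 1` are `hasSum_pow_div_one_sub_pow_sq`
and `hasSum_lambertTerm`. -/
noncomputable def lambertSum (q : ℂ) : ℂ :=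
  ∑' p : ℕ+ × ℕ+, (p.2 : ℂ) * q ^ (p.1 * p.2 : ℕ)

theorem norm_pow_pnat_lt_one {q : ℂ} (hq : ‖q‖ < 1) (n : ℕ+) : ‖q ^ (n : ℕ)‖ < 1 := by
  rw [norm_pow]
  exact pow_lt_one₀ (norm_nonneg _) hq n.ne_zero

theorem summable_pnat_mul_pow {q : ℂ} (hq : ‖q‖ < 1) :
    Summable fun p : ℕ+ × ℕ+ => (p.2 : ℂ) * q ^ (p.1 * p.2 : ℕ) := by
  simpa using summable_prod_mul_pow 1 hq

theorem hasSum_pow_div_one_sub_pow_sq {q : ℂ} (hq : ‖q‖ < 1) :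
    HasSum (fun n : ℕ+ => q ^ (n : ℕ) / (1 - q ^ (n : ℕ)) ^ 2) (lambertSum q) := by
  refine (summable_pnat_mul_pow hq).hasSum.prod_fiberwise fun d => ?_
  have h := hasSum_coe_mul_geometric_of_norm_lt_one (norm_pow_pnat_lt_one hq d)
  rw [← PNat.coe_injective.hasSum_iff] at h
  · simpa [Function.comp_def, pow_mul] using h
  · intro n hn
    rcases n with _ | n
    · simp
    · exact absurd ⟨n.succPNat, rfl⟩ hn

theorem hasSum_lambertTerm {q : ℂ} (hq : ‖q‖ < 1) :
    HasSum (fun n : ℕ+ => lambertTerm q n) (lambertSum q) := by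
  have hs := (Equiv.prodComm ℕ+ ℕ+).hasSum_iff.mpr (summable_pnat_mul_pow hq).hasSum
  refine hs.prod_fiberwise fun c => ?_
  have h := (hasSum_geometric_of_norm_lt_one (norm_pow_pnat_lt_one hq c)).mul_left
    ((c : ℂ) * q ^ (c : ℕ))
  rw [← Equiv.pnatEquivNat.hasSum_iff] at h
  rw [lambertTerm, div_eq_mul_inv]
  refine h.congr_fun fun d => ?_
  have e : (d : ℕ) = Equiv.pnatEquivNat d + 1 := by simp
  simp only [Function.comp_apply, Equiv.prodComm_apply, Prod.swap, e]
  ring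

/-! ### Summation of a Bailey pair -/

/-- The coefficient with which `α (r + 1)` enters the sum of `(q)_n² q ^ (n + 1) β (n + 1)`, for a
Bailey pair `(α, β)`. -/
noncomputable def baileyCoeff (q : ℂ) (n r : ℕ) : ℂ :=
  if r ≤ n then qPoch q q n ^ 2 * q ^ (n + 1) / (qPoch q q (n - r) * qPoch q q (n + r + 2)) else 0

theorem exists_norm_baileyCoeff_le {q : ℂ} (hq : ‖q‖ < 1) :
    ∃ C, 0 < C ∧ ∀ n r, ‖baileyCoeff q n r‖ ≤ C * ‖q‖ ^ n := by
  obtain ⟨C, hC, hu⟩ := exists_norm_qPoch_le hq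
  obtain ⟨D, hD, hv⟩ := exists_norm_qPoch_inv_le hq
  refine ⟨C ^ 2 * D * D, by positivity, fun n r => ?_⟩
  unfold baileyCoeff
  split_ifs with h
  · rw [div_eq_mul_inv, mul_inv, norm_mul, norm_mul, norm_mul, norm_pow, norm_pow]
    calc ‖qPoch q q n‖ ^ 2 * ‖q‖ ^ (n + 1) *
          (‖(qPoch q q (n - r))⁻¹‖ * ‖(qPoch q q (n + r + 2))⁻¹‖)
        ≤ C ^ 2 * ‖q‖ ^ n * (D * D) := by
          gcongr ?_ ^ 2 * ?_ * (?_ * ?_)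
          · exact hu n
          · exact pow_le_pow_of_le_one (norm_nonneg _) hq.le n.le_succ
          · exact hv _
          · exact hv _
      _ = _ := by ring
  · simp only [norm_zero]
    positivity

/-- The sum telescopes, which replaces an appeal to the `q`-Gauss sum. -/
theorem sum_range_baileyCoeff {q : ℂ} (hq : ‖q‖ < 1) (r M : ℕ) :
    (1 - q ^ (r + 1)) ^ 2 * ∑ n ∈ Finset.range M, baileyCoeff q n r =
      if r + 1 ≤ M then q ^ (r + 1) * qPoch q q M ^ 2 /
        (qPoch q q (M - (r + 1)) * qPoch q q (M + (r + 1))) else 0 := by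
  have hne := qPoch_self_ne_zero hq
  have h1 := one_sub_pow_succ_ne_zero hq
  induction M with
  | zero => simp
  | succ M ih =>
    rw [Finset.sum_range_succ, mul_add, ih]
    unfold baileyCoeff
    rcases lt_trichotomy M r with h | rfl | h
    · rw [if_neg (by omega), if_neg (by omega), if_neg (by omega)]
      simp
    · rw [if_neg (by omega), if_pos le_rfl, if_pos le_rfl, Nat.sub_self, Nat.sub_self, qPoch_zero,
        qPoch_self_succ q M, show M + 1 + (M + 1) = M + M + 2 by ring]
      ring
    · obtain ⟨m, rfl⟩ := Nat.exists_eq_add_of_lt h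
      rw [if_pos (by omega), if_pos (by omega), if_pos (by omega),
        show r + m + 1 - (r + 1) = m by omega, show r + m + 1 - r = m + 1 by omega,
        show r + m + 1 + 1 - (r + 1) = m + 1 by omega,
        show r + m + 1 + 1 + (r + 1) = r + m + 1 + (r + 1) + 1 by ring,
        show r + m + 1 + r + 2 = r + m + 1 + (r + 1) + 1 by ring, qPoch_self_succ q m,
        qPoch_self_succ q (r + m + 1), qPoch_self_succ q (r + m + 1 + (r + 1))]
      have := hne m
      have := h1 m
      have := hne (r + m + 1 + (r + 1))
      have := h1 (r + m + 1 + (r + 1))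
      field_simp
      ring

theorem hasSum_baileyCoeff {q : ℂ} (hq : ‖q‖ < 1) (r : ℕ) :
    HasSum (fun n => baileyCoeff q n r) (q ^ (r + 1) / (1 - q ^ (r + 1)) ^ 2) := by
  have hs : Summable fun n => baileyCoeff q n r := by
    obtain ⟨C, hC, h⟩ := exists_norm_baileyCoeff_le hq
    exact .of_norm_bounded ((summable_geometric_of_lt_one (norm_nonneg q) hq).mul_left C)
      fun n => h n r
  have hne := qPochInf_self_ne_zero hq
  have h1 := one_sub_pow_succ_ne_zero hq r
  have ht : Tendsto (fun M => (1 - q ^ (r + 1)) ^ 2 * ∑ n ∈ Finset.range M, baileyCoeff q n r)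
      atTop (𝓝 (q ^ (r + 1) * qPochInf q q ^ 2 / (qPochInf q q * qPochInf q q))) := by
    have hu := tendsto_qPoch q q hq
    refine Tendsto.congr' ?_ (((hu.pow 2).const_mul (q ^ (r + 1))).div
      ((hu.comp (tendsto_sub_atTop_nat (r + 1))).mul (hu.comp (tendsto_add_atTop_nat (r + 1))))
      (mul_ne_zero hne hne))
    filter_upwards [eventually_ge_atTop (r + 1)] with M hM
    rw [sum_range_baileyCoeff hq, if_pos hM]
    rfl
  have h := tendsto_nhds_unique (hs.hasSum.tendsto_sum_nat.const_mul ((1 - q ^ (r + 1)) ^ 2)) ht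
  convert hs.hasSum using 1
  rw [div_eq_iff (pow_ne_zero 2 h1), mul_comm, h]
  field_simp

open Finset in
/-- Summing a Bailey pair with `α 0 = 1` against `(q)_{n-1}² q ^ n`: the interchange of the two
summations, with the inner sums evaluated by `hasSum_baileyCoeff`. -/
theorem tsum_baileyPair {q : ℂ} (hq : ‖q‖ < 1) {α β : ℕ → ℂ} (h : IsBaileyPair q α β)
    (h0 : α 0 = 1) (hα : Summable fun r => ‖α (r + 1)‖) :
    ∑' n, qPoch q q n ^ 2 * q ^ (n + 1) * β (n + 1) =
      ∑' n : ℕ, q ^ (n + 1) / (1 - q ^ (n + 1)) ^ 2 +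
        ∑' r : ℕ, α (r + 1) * (q ^ (r + 1) / (1 - q ^ (r + 1)) ^ 2) := by
  have hne := qPoch_self_ne_zero hq
  obtain ⟨C, hC, hb⟩ := exists_norm_baileyCoeff_le hq
  have hgeo := summable_geometric_of_lt_one (norm_nonneg q) hq
  have hs2 : Summable (Function.uncurry fun n r : ℕ => α (r + 1) * baileyCoeff q n r) := by
    refine .of_norm_bounded ((hgeo.mul_left C).mul_of_nonneg hα
      (fun n => by simp only [Pi.zero_apply]; positivity)
      (fun r => norm_nonneg _)) fun p => ?_
    simp only [Function.uncurry, norm_mul]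
    rw [mul_comm]
    gcongr
    exact hb _ _
  have hfin : ∀ n, ∑' r, α (r + 1) * baileyCoeff q n r =
      ∑ r ∈ range (n + 1), α (r + 1) * baileyCoeff q n r := fun n =>
    tsum_eq_sum fun r hr => by
      rw [baileyCoeff, if_neg (by simpa using hr), mul_zero]
  have hterm : ∀ n, qPoch q q n ^ 2 * q ^ (n + 1) * β (n + 1) =
      q ^ (n + 1) / (1 - q ^ (n + 1)) ^ 2 + ∑' r, α (r + 1) * baileyCoeff q n r := by
    intro n
    rw [hfin, h (n + 1), sum_range_succ', mul_add, add_comm, mul_sum]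
    congr 1
    · rw [h0, Nat.sub_zero, add_zero, qPoch_self_succ]
      have := hne n
      have := one_sub_pow_succ_ne_zero hq n
      field_simp
    · refine sum_congr rfl fun r hr => ?_
      rw [baileyCoeff, if_pos (Nat.lt_succ_iff.mp (mem_range.mp hr)), Nat.add_sub_add_right,
        show n + 1 + (r + 1) = n + r + 2 by ring]
      ring
  have hs1 : Summable fun n : ℕ => q ^ (n + 1) / (1 - q ^ (n + 1)) ^ 2 :=
    (summable_pnat_iff_summable_succ (f := fun n => q ^ n / (1 - q ^ n) ^ 2)).mp
      (hasSum_pow_div_one_sub_pow_sq hq).summable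
  have hs3 : Summable fun n => ∑' r, α (r + 1) * baileyCoeff q n r := hs2.prod
  rw [tsum_congr hterm, hs1.tsum_add hs3, ← hs2.tsum_comm]
  congr 1
  refine tsum_congr fun r => ?_
  exact ((hasSum_baileyCoeff hq r).mul_left _).tsum_eq

/-! ### Sums over chains -/

/-- The factor `1 / (q)_{b - a}` of the summand, extended by zero to all pairs of integers. -/
noncomputable def chainKernel (q : ℂ) (a b : ℕ) : ℂ :=
  if a ≤ b then (qPoch q q (b - a))⁻¹ else 0

/-- The part of `chainTerm` that is not a function of the last entry alone, extended by zero to all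
tuples of natural numbers. -/
noncomputable def chainWeight (q : ℂ) (j : ℕ) (n : Fin (j + 1) → ℕ) : ℂ :=
  if n 0 = 0 then ∏ i : Fin j, q ^ n i.castSucc ^ 2 * chainKernel q (n i.castSucc) (n i.succ) else 0

theorem chainWeight_snoc (q : ℂ) (j : ℕ) (n : Fin (j + 1) → ℕ) (m : ℕ) :
    chainWeight q (j + 1) (Fin.snocEquiv (fun _ => ℕ) (m, n)) =
      chainWeight q j n * (q ^ n (Fin.last j) ^ 2 * chainKernel q (n (Fin.last j)) m) := by
  have hc (i : Fin (j + 1)) : Fin.snocEquiv (fun _ => ℕ) (m, n) i.castSucc = n i := by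
    simp [Fin.snocEquiv]
  have hl : Fin.snocEquiv (fun _ => ℕ) (m, n) (Fin.last (j + 1)) = m := by
    simp [Fin.snocEquiv]
  unfold chainWeight
  rw [← Fin.castSucc_zero, hc, Fin.prod_univ_castSucc]
  simp only [Fin.succ_castSucc, hc, Fin.succ_last, hl]
  split_ifs <;> simp

/-- Summing `chainWeight` over the tuples with a given last entry `N` gives the second member of the
Bailey pair that arises from the unit pair by `j` steps. -/
theorem hasSum_chainWeight (q : ℂ) (j N : ℕ) :
    HasSum (fun n : Fin (j + 1) → ℕ => if n (Fin.last j) = N then chainWeight q j n else 0)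
      (baileyBeta q j N) := by
  induction j generalizing N with
  | zero =>
    have h := hasSum_single (f := fun n : Fin 1 → ℕ =>
      if n (Fin.last 0) = N then chainWeight q 0 n else 0) (fun _ => 0) fun n hn => by
        have h0 : n 0 ≠ 0 := fun h => hn (by ext i; rw [Fin.fin_one_eq_zero i, h])
        simp [chainWeight, h0]
    convert h using 1
    simp [baileyBeta, chainWeight, eq_comm]
  | succ j ih =>
    rw [← (Fin.snocEquiv fun _ => ℕ).hasSum_iff]
    have hinj : Function.Injective fun n : Fin (j + 1) → ℕ => (N, n) :=
      fun _ _ h => (Prod.mk.inj h).2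
    have hl (p : ℕ × (Fin (j + 1) → ℕ)) :
        Fin.snocEquiv (fun _ => ℕ) p (Fin.last (j + 1)) = p.1 := by
      simp [Fin.snocEquiv]
    rw [← hinj.hasSum_iff]
    · have h := hasSum_sum (s := Finset.range (N + 1)) fun s _ =>
        (ih s).mul_right (q ^ s ^ 2 / qPoch q q (N - s))
      have e : baileyBeta q (j + 1) N =
          ∑ s ∈ Finset.range (N + 1), baileyBeta q j s * (q ^ s ^ 2 / qPoch q q (N - s)) := by
        simp only [baileyBeta, baileyStep]
        refine Finset.sum_congr rfl fun s _ => ?_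
        ring
      rw [e]
      refine h.congr_fun fun n => ?_
      simp only [Function.comp_apply, hl, if_true]
      rw [chainWeight_snoc]
      simp only [ite_mul, zero_mul, Finset.sum_ite_eq, Finset.mem_range, Nat.lt_succ_iff]
      unfold chainKernel
      split_ifs <;> simp [div_eq_mul_inv]
    · rintro ⟨m, n⟩ hp
      simp only [Function.comp_apply, hl]
      rw [if_neg]
      rintro rfl
      exact hp ⟨n, rfl⟩

theorem summable_norm_chainWeight {q : ℂ} (hq : ‖q‖ < 1) (j : ℕ) (f : ℕ → ℂ)
    (hf : Summable fun N => ‖f N‖) :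
    Summable fun n : Fin (j + 1) → ℕ => ‖chainWeight q j n * f (n (Fin.last j))‖ := by
  induction j generalizing f with
  | zero =>
    refine summable_of_ne_finset_zero (s := {fun _ => 0}) fun n hn => ?_
    have h0 : n 0 ≠ 0 := fun h => hn (by
      rw [Finset.mem_singleton]
      ext i
      rw [Fin.fin_one_eq_zero i, h])
    simp [chainWeight, h0]
  | succ j ih =>
    obtain ⟨C, hC, hK⟩ := exists_norm_qPoch_inv_le hq
    rw [← (Fin.snocEquiv fun _ => ℕ).summable_iff]
    have hsq : Summable fun N : ℕ => ‖q ^ N ^ 2‖ := by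
      refine (summable_geometric_of_lt_one (norm_nonneg q) hq).of_nonneg_of_le
        (fun _ => norm_nonneg _) fun N => ?_
      rw [norm_pow]
      exact pow_le_pow_of_le_one (norm_nonneg _) hq.le (Nat.le_self_pow two_ne_zero N)
    refine ((hf.mul_left C).mul_of_nonneg (ih _ hsq)
      (fun _ => by simp only [Pi.zero_apply]; positivity)
      (fun _ => norm_nonneg _)).of_nonneg_of_le (fun _ => norm_nonneg _) ?_
    rintro ⟨m, n⟩
    have hl : Fin.snocEquiv (fun _ => ℕ) (m, n) (Fin.last (j + 1)) = m := by
      simp [Fin.snocEquiv]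
    simp only [Function.comp_apply]
    rw [chainWeight_snoc, hl]
    have hk : ‖chainKernel q (n (Fin.last j)) m‖ ≤ C := by
      unfold chainKernel
      split_ifs
      · exact hK _
      · simpa using hC.le
    simp only [norm_mul]
    calc _ = ‖chainKernel q (n (Fin.last j)) m‖ * ‖f m‖ *
          (‖chainWeight q j n‖ * ‖q ^ n (Fin.last j) ^ 2‖) := by ring
      _ ≤ _ := by gcongr

theorem hasSum_chainWeight_mul {q : ℂ} (hq : ‖q‖ < 1) (j : ℕ) (f : ℕ → ℂ)
    (hf : Summable fun N => ‖f N‖) :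
    HasSum (fun n : Fin (j + 1) → ℕ => chainWeight q j n * f (n (Fin.last j)))
      (∑' N, f N * baileyBeta q j N) := by
  have hs := (summable_norm_chainWeight hq j f hf).of_norm.hasSum
  have h := hs.tsum_fiberwise fun n => n (Fin.last j)
  have e (N : ℕ) : ∑' n : (fun n : Fin (j + 1) → ℕ => n (Fin.last j)) ⁻¹' {N},
      chainWeight q j n * f (n.1 (Fin.last j)) = f N * baileyBeta q j N := by
    rw [tsum_subtype ((fun n : Fin (j + 1) → ℕ => n (Fin.last j)) ⁻¹' {N})
      (fun n => chainWeight q j n * f (n (Fin.last j)))]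
    refine HasSum.tsum_eq (((hasSum_chainWeight q j N).mul_left (f N)).congr_fun fun n => ?_)
    by_cases hn : n (Fin.last j) = N
    · simp [Set.indicator, hn, mul_comm]
    · simp [Set.indicator, hn]
  simp only [e] at h
  rwa [h.tsum_eq]

/-- The part of `chainTerm` that depends on the last entry `N` alone. Division by zero makes its
value at `N = 0` zero. -/
noncomputable def lastFactor (q : ℂ) (N : ℕ) : ℂ :=
  q ^ N * qPoch q q N / ((1 - q ^ N) ^ 2 * qPochInf (q ^ (N + 1)) q)

theorem lastFactor_succ {q : ℂ} (hq : ‖q‖ < 1) (N : ℕ) :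
    lastFactor q (N + 1) = 1 / qPochInf q q * (qPoch q q N ^ 2 * q ^ (N + 1)) := by
  have h := qPoch_mul_qPochInf hq (N + 1)
  have h1 := qPochInf_self_ne_zero hq
  have h2 : qPochInf (q ^ (N + 1 + 1)) q ≠ 0 := right_ne_zero_of_mul (h ▸ h1)
  have h3 := one_sub_pow_succ_ne_zero hq N
  have h4 := qPoch_self_ne_zero hq N
  rw [lastFactor, ← h, qPoch_self_succ]
  field_simp

theorem summable_norm_lastFactor {q : ℂ} (hq : ‖q‖ < 1) :
    Summable fun N => ‖lastFactor q N‖ := by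
  obtain ⟨C, hC, hu⟩ := exists_norm_qPoch_le hq
  rw [← summable_nat_add_iff 1]
  refine ((summable_geometric_of_lt_one (norm_nonneg q) hq).mul_left
    (‖1 / qPochInf q q‖ * C ^ 2 * ‖q‖)).of_nonneg_of_le (fun _ => norm_nonneg _) fun N => ?_
  rw [lastFactor_succ hq, norm_mul, norm_mul, norm_pow, norm_pow, pow_succ' ‖q‖]
  calc ‖1 / qPochInf q q‖ * (‖qPoch q q N‖ ^ 2 * (‖q‖ * ‖q‖ ^ N))
      ≤ ‖1 / qPochInf q q‖ * (C ^ 2 * (‖q‖ * ‖q‖ ^ N)) := by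
        gcongr
        exact hu N
    _ = _ := by ring

theorem chainWeight_mul_lastFactor (q : ℂ) (j : ℕ) :
    (fun n => chainWeight q j n * lastFactor q (n (Fin.last j))) =
      (chains j).indicator (chainTerm q j) := by
  ext n
  by_cases hn : n ∈ chains j
  · rw [Set.indicator_of_mem hn]
    obtain ⟨hm, h0, -⟩ := hn
    have hk (i : Fin j) : chainKernel q (n i.castSucc) (n i.succ) =
        (qPoch q q (n i.succ - n i.castSucc))⁻¹ :=
      if_pos (hm i.castSucc_le_succ)
    rw [chainWeight, if_pos h0, Finset.prod_mul_distrib, Finset.prod_pow_eq_pow_sum]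
    simp only [hk, Finset.prod_inv_distrib, lastFactor, chainTerm, pow_add, div_eq_mul_inv, mul_inv]
    ring
  · rw [Set.indicator_of_notMem hn]
    by_cases h0 : n 0 = 0
    swap
    · rw [chainWeight, if_neg h0, zero_mul]
    by_cases hl : n (Fin.last j) = 0
    · simp [lastFactor, hl]
    have hm : ¬ Monotone n := fun hm => hn ⟨hm, h0, Nat.one_le_iff_ne_zero.mpr hl⟩
    rw [Fin.monotone_iff_le_succ] at hm
    push Not at hm
    obtain ⟨i, hi⟩ := hm
    rw [chainWeight, if_pos h0, Finset.prod_eq_zero (Finset.mem_univ i), zero_mul]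
    rw [chainKernel, if_neg hi.not_ge, mul_zero]

theorem hasSum_chainTerm {q : ℂ} (hq : ‖q‖ < 1) (j : ℕ) :
    HasSum (fun n : chains j => chainTerm q j n)
      (1 / qPochInf q q * ∑' N, qPoch q q N ^ 2 * q ^ (N + 1) * baileyBeta q j (N + 1)) := by
  have h := hasSum_chainWeight_mul hq j _ (summable_norm_lastFactor hq)
  rw [chainWeight_mul_lastFactor, ← hasSum_subtype_iff_indicator, ← Nat.succ_injective.tsum_eq] at h
  · rw [← tsum_mul_left]
    refine (congrArg (HasSum _) (tsum_congr fun N => ?_)).mp h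
    rw [Nat.succ_eq_add_one, lastFactor_succ hq]
    ring
  · intro N hN
    rcases N with _ | N
    · simp [lastFactor] at hN
    · exact ⟨N, rfl⟩

/-! ### The rank series and the identity -/

theorem baileyAlpha_succ_mul (q : ℂ) (j r : ℕ) :
    baileyAlpha q j (r + 1) * (q ^ (r + 1) / (1 - q ^ (r + 1)) ^ 2) = rankTerm q j (r + 1) := by
  have e : (r + 1) * ((2 * j + 1) * (r + 1) + 1) / 2 =
      j * (r + 1) ^ 2 + (r + 1) * (r + 1 - 1) / 2 + (r + 1) := by
    rw [show (r + 1) * ((2 * j + 1) * (r + 1) + 1) =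
      (r + 1) * (r + 1 - 1) + (j * (r + 1) ^ 2 + (r + 1)) * 2 by rw [Nat.add_sub_cancel]; ring,
      Nat.add_mul_div_right _ _ two_pos]
    ring
  rw [baileyAlpha, if_neg r.succ_ne_zero, rankTerm, e, pow_add q _ (r + 1)]
  ring

theorem norm_baileyAlpha_succ_le {q : ℂ} (hq : ‖q‖ < 1) {j : ℕ} (hj : 1 ≤ j) (r : ℕ) :
    ‖baileyAlpha q j (r + 1)‖ ≤ 2 * ‖q‖ ^ r := by
  have h2 : ‖1 + q ^ (r + 1)‖ ≤ 2 := by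
    refine (norm_add_le _ _).trans ?_
    rw [norm_one, norm_pow]
    have := pow_le_one₀ (n := r + 1) (norm_nonneg q) hq.le
    linarith
  rw [baileyAlpha, if_neg r.succ_ne_zero, norm_mul, norm_mul, norm_pow, norm_pow, norm_neg,
    norm_one, one_pow, one_mul, mul_comm]
  have hexp : r ≤ j * (r + 1) ^ 2 + (r + 1) * (r + 1 - 1) / 2 := by
    nlinarith [Nat.zero_le ((r + 1) * (r + 1 - 1) / 2), Nat.mul_le_mul_right ((r + 1) ^ 2) hj]
  have := pow_le_pow_of_le_one (norm_nonneg q) hq.le hexp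
  gcongr

theorem summable_norm_baileyAlpha {q : ℂ} (hq : ‖q‖ < 1) {j : ℕ} (hj : 1 ≤ j) :
    Summable fun r => ‖baileyAlpha q j (r + 1)‖ :=
  ((summable_geometric_of_lt_one (norm_nonneg q) hq).mul_left 2).of_nonneg_of_le
    (fun _ => norm_nonneg _) (norm_baileyAlpha_succ_le hq hj)

theorem summable_rankTerm {q : ℂ} (hq : ‖q‖ < 1) {j : ℕ} (hj : 1 ≤ j) :
    Summable fun n : ℕ+ => rankTerm q j n := by
  rw [summable_pnat_iff_summable_succ (f := rankTerm q j)]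
  have h := (summable_pnat_iff_summable_succ (f := fun n => q ^ n / (1 - q ^ n) ^ 2)).mp
    (hasSum_pow_div_one_sub_pow_sq hq).summable
  refine .of_norm_bounded (h.norm.mul_left 2) fun r => ?_
  rw [← baileyAlpha_succ_mul, norm_mul]
  gcongr
  exact (norm_baileyAlpha_succ_le hq hj r).trans
    (mul_le_of_le_one_right zero_le_two (pow_le_one₀ (norm_nonneg q) hq.le))

theorem theorem2p1 (j : ℕ) (hj : 1 ≤ j) (q : ℂ) (hq : ‖q‖ < 1) :
    Summable (fun n : chains j => chainTerm q j n) ∧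
    Summable (fun n : ℕ+ => lambertTerm q n) ∧
    Summable (fun n : ℕ+ => rankTerm q j n) ∧
    (∑' n : chains j, chainTerm q j n) =
      1 / qPochInf q q * (∑' n : ℕ+, lambertTerm q n) +
      1 / qPochInf q q * (∑' n : ℕ+, rankTerm q j n) := by
  refine ⟨(hasSum_chainTerm hq j).summable, (hasSum_lambertTerm hq).summable,
    summable_rankTerm hq hj, ?_⟩
  rw [(hasSum_chainTerm hq j).tsum_eq, (hasSum_lambertTerm hq).tsum_eq,
    tsum_baileyPair hq (isBaileyPair_baileyAlpha_baileyBeta hq j) (by simp [baileyAlpha])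
      (summable_norm_baileyAlpha hq hj), mul_add,
    ← (hasSum_pow_div_one_sub_pow_sq hq).tsum_eq,
    tsum_pnat_eq_tsum_succ (f := fun n => q ^ n / (1 - q ^ n) ^ 2),
    tsum_pnat_eq_tsum_succ (f := rankTerm q j)]
  simp only [baileyAlpha_succ_mul]
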